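/- Let $n\ge 1$. Call a set $A\subseteq\omega$ an $E^1_n$ set if it is (lightface) $\Pi^1_n$ when $n$ is odd, and (lightface) $\Sigma^1_n$ when $n$ is even. A numbering of a family $\mathcal S\subseteq P(\omega)$ is a surjective map $\nu\colon\omega\to\mathcal S$; it is $E^1_n$-computable if $G_\nu=\{\langle k,x\rangle : x\in\nu(k)\}$ is an $E^1_n$ set. For numberings $\nu,\mu$ write $\nu\le\mu$ if there is a total computable function $f\colon\omega\to\omega$ with $\nu(k)=\mu(f(k))$ for all $k$, and $\nu\equiv\mu$ if $\nu\le\mu$ and $\mu\le\nu$. The Rogers semilattice $\mathcal R^1_n(\mathcal S)$ is the upper semilattice of all $\equiv$-classes of $E^1_n$-computable numberings of $\mathcal S$, ordered by $\le$, with joins induced by $(\nu\oplus\mu)(2x)=\nu(x)$, $(\nu\oplus\mu)(2x+1)=\mu(x)$. Proposition. Let $\mathcal S$ be a finite family of $E^1_n$ sets which contains at least two elements. Then the Rogers semilattice $\mathcal R^1_n(\mathcal S)$ is infinite, and it is not a lattice (that is, some two of its elements have no greatest lower bound). -/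

import Mathlib

/-! ### Computation relative to a total oracle, with indices uniform in the oracle -/

/-- Indices (programs) of functions that are partial recursive in an oracle `g : ℕ → ℕ`. -/
inductive OracleCode : Type
  | zero : OracleCode
  | succ : OracleCode
  | left : OracleCode
  | right : OracleCode
  | oracle : OracleCode
  | pair : OracleCode → OracleCode → OracleCode
  | comp : OracleCode → OracleCode → OracleCode
  | prec : OracleCode → OracleCode → OracleCode
  | rfind : OracleCode → OracleCode

/-- `OracleCode.eval g e` is the partial function `φ_e^g`; the clauses are those of
`Nat.RecursiveIn`. -/
def OracleCode.eval (g : ℕ → ℕ) : OracleCode → ℕ →. ℕ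
  | .zero => fun _ => Part.some 0
  | .succ => fun k => Part.some (k + 1)
  | .left => fun k => Part.some (Nat.unpair k).1
  | .right => fun k => Part.some (Nat.unpair k).2
  | .oracle => fun k => Part.some (g k)
  | .pair c d => fun k => Nat.pair <$> OracleCode.eval g c k <*> OracleCode.eval g d k
  | .comp c d => fun k => (OracleCode.eval g d k).bind (OracleCode.eval g c)
  | .prec c d => Nat.unpaired fun a k =>
      k.rec (OracleCode.eval g c a) fun y IH => do
        let i ← IH
        OracleCode.eval g d (Nat.pair a (Nat.pair y i))
  | .rfind c => fun a => Nat.rfind fun k =>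
      (fun m => decide (m = 0)) <$> OracleCode.eval g c (Nat.pair a k)

/-- The join `f₁ ⊕ ⋯ ⊕ fₙ` of finitely many functions, used as an oracle: the value of the
`i`-th function at `k` is stored at `⟨i, k⟩`. -/
def joinFun {n : ℕ} (f : Fin n → ℕ → ℕ) : ℕ → ℕ := fun m =>
  if h : (Nat.unpair m).1 < n then f ⟨(Nat.unpair m).1, h⟩ (Nat.unpair m).2 else 0

/-- The predicate `R(x, y; f₁, …, fₙ)` is recursive: some index `e` is such that
`φ_e^{f₁ ⊕ ⋯ ⊕ fₙ}(x, y)` is always defined, and equals `1` exactly when `R` holds. -/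
def IsRecursivePred {n : ℕ} (R : (Fin n → ℕ → ℕ) → ℕ → ℕ → Prop) : Prop :=
  ∃ e : OracleCode, ∀ (f : Fin n → ℕ → ℕ) (x y : ℕ),
    (OracleCode.eval (joinFun f) e (Nat.pair x y)).Dom ∧
      (R f x y ↔ 1 ∈ OracleCode.eval (joinFun f) e (Nat.pair x y))

/-! ### The analytical hierarchy -/

/-- The alternating quantifier prefix `(Q₁ f₁) (Q₂ f₂) ⋯ (Qₙ fₙ) (Qₙ₊₁ y)` applied to `P`, where
the `fᵢ` range over `ω^ω` and `y` ranges over `ω`. The first quantifier is `∀` for `true` and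
`∃` for `false`, and consecutive quantifiers alternate (including the last one, over numbers). -/
def AlternatingPrefix : Bool → (n : ℕ) → ((Fin n → ℕ → ℕ) → ℕ → Prop) → Prop
  | true, 0, P => ∀ y : ℕ, P Fin.elim0 y
  | false, 0, P => ∃ y : ℕ, P Fin.elim0 y
  | true, n + 1, P => ∀ f : ℕ → ℕ, AlternatingPrefix false n fun fs => P (Fin.cons f fs)
  | false, n + 1, P => ∃ f : ℕ → ℕ, AlternatingPrefix true n fun fs => P (Fin.cons f fs)

/-- Sets of numbers with an analytical normal form with `n` function quantifiers, the first of
which is `∀` for `true` and `∃` for `false`. -/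
def HasAnalyticalForm (b : Bool) (n : ℕ) (X : Set ℕ) : Prop :=
  ∃ R : (Fin n → ℕ → ℕ) → ℕ → ℕ → Prop, IsRecursivePred R ∧
    ∀ a : ℕ, a ∈ X ↔ AlternatingPrefix b n fun f y => R f a y

/-- `X` is a (lightface) `Π¹ₙ` set, for `n ≥ 1`. -/
def IsPi1 (n : ℕ) (X : Set ℕ) : Prop := HasAnalyticalForm true n X

/-- `X` is a (lightface) `Σ¹ₙ` set, for `n ≥ 1`. -/
def IsSigma1 (n : ℕ) (X : Set ℕ) : Prop := HasAnalyticalForm false n X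

/-- `X` is an `E¹ₙ` set, for `n ≥ 1`: `Π¹ₙ` if `n` is odd and `Σ¹ₙ` if `n` is even. -/
def IsE1 (n : ℕ) (X : Set ℕ) : Prop :=
  (Odd n ∧ IsPi1 n X) ∨ (Even n ∧ IsSigma1 n X)

/-! ### Numberings -/

/-- `ν` is reducible to `μ`: `ν = μ ∘ f` for some total computable `f`. -/
def NumberingReducible (ν μ : ℕ → Set ℕ) : Prop :=
  ∃ f : ℕ → ℕ, Computable f ∧ ∀ k, ν k = μ (f k)

/-- `G_ν = {⟨k, x⟩ : x ∈ ν(k)}`. -/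
def numberingGraph (ν : ℕ → Set ℕ) : Set ℕ :=
  {z | (Nat.unpair z).2 ∈ ν (Nat.unpair z).1}

/-- `(ν ⊕ μ)(2x) = ν(x)` and `(ν ⊕ μ)(2x + 1) = μ(x)`. -/
def numberingJoin (ν μ : ℕ → Set ℕ) : ℕ → Set ℕ := fun k =>
  if k % 2 = 0 then ν (k / 2) else μ (k / 2)

/-- The `E¹ₙ`-computable numberings of the family `S`. -/
def E1Numbering (n : ℕ) (S : Set (Set ℕ)) : Type :=
  {ν : ℕ → Set ℕ // Set.range ν = S ∧ IsE1 n (numberingGraph ν)}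

/-- The preorder on numberings is reducibility. -/
instance E1Numbering.instPreorder (n : ℕ) (S : Set (Set ℕ)) : Preorder (E1Numbering n S) where
  le ν μ := NumberingReducible ν.1 μ.1
  le_refl _ := ⟨id, Computable.id, fun _ => rfl⟩
  le_trans _ _ _ := fun ⟨f, hf, h⟩ ⟨g, hg, h'⟩ =>
    ⟨g ∘ f, hg.comp hf, fun k => (h k).trans (h' (f k))⟩

/-- The underlying partial order of the Rogers semilattice `R¹ₙ(S)`: the quotient of the
`E¹ₙ`-computable numberings of `S` by mutual reducibility, ordered by reducibility. -/
abbrev RogersE1 (n : ℕ) (S : Set (Set ℕ)) : Type :=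
  Antisymmetrization (E1Numbering n S) (· ≤ ·)

/-! ### The join operation on the Rogers semilattice -/

theorem OracleCode.exists_of_partrec {f : ℕ →. ℕ} (hf : Nat.Partrec f) :
    ∃ c : OracleCode, ∀ g, OracleCode.eval g c = f := by
  induction hf with
  | zero => exact ⟨.zero, fun g => rfl⟩
  | succ => exact ⟨.succ, fun g => rfl⟩
  | left => exact ⟨.left, fun g => rfl⟩
  | right => exact ⟨.right, fun g => rfl⟩
  | pair _ _ h1 h2 =>
    obtain ⟨c, hc⟩ := h1
    obtain ⟨d, hd⟩ := h2
    exact ⟨.pair c d, fun g => by simp only [OracleCode.eval, hc, hd]; rfl⟩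
  | comp _ _ h1 h2 =>
    obtain ⟨c, hc⟩ := h1
    obtain ⟨d, hd⟩ := h2
    exact ⟨.comp c d, fun g => by simp only [OracleCode.eval, hc, hd]; rfl⟩
  | prec _ _ h1 h2 =>
    obtain ⟨c, hc⟩ := h1
    obtain ⟨d, hd⟩ := h2
    exact ⟨.prec c d, fun g => by simp only [OracleCode.eval, hc, hd]; rfl⟩
  | rfind _ h1 =>
    obtain ⟨c, hc⟩ := h1
    exact ⟨.rfind c, fun g => by simp only [OracleCode.eval, hc]; rfl⟩

theorem OracleCode.exists_of_computable {f : ℕ → ℕ} (hf : Computable f) :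
    ∃ c : OracleCode, ∀ g k, OracleCode.eval g c k = Part.some (f k) := by
  obtain ⟨c, hc⟩ := OracleCode.exists_of_partrec (Partrec.nat_iff.1 hf)
  exact ⟨c, fun g k => by rw [hc]; rfl⟩

theorem OracleCode.eval_comp {g : ℕ → ℕ} {c d : OracleCode} {k v : ℕ}
    (h : OracleCode.eval g d k = Part.some v) :
    OracleCode.eval g (.comp c d) k = OracleCode.eval g c v := by
  change (OracleCode.eval g d k).bind (OracleCode.eval g c) = _
  rw [h]
  exact Part.bind_some _ _

theorem OracleCode.eval_pair {g : ℕ → ℕ} {c d : OracleCode} {k v w : ℕ}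
    (h₁ : OracleCode.eval g c k = Part.some v) (h₂ : OracleCode.eval g d k = Part.some w) :
    OracleCode.eval g (.pair c d) k = Part.some (Nat.pair v w) := by
  change Nat.pair <$> OracleCode.eval g c k <*> OracleCode.eval g d k = _
  rw [h₁, h₂]
  simp [Seq.seq]

theorem HasAnalyticalForm.cases {b : Bool} {n : ℕ} {P Q : Set ℕ}
    (hP : HasAnalyticalForm b n P) (hQ : HasAnalyticalForm b n Q) {s h : ℕ → ℕ}
    (hs : Computable s) (hh : Computable h) :
    HasAnalyticalForm b n {x | if s x = 0 then h x ∈ P else h x ∈ Q} := by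
  obtain ⟨R₀, ⟨e₀, he₀⟩, hR₀⟩ := hP
  obtain ⟨R₁, ⟨e₁, he₁⟩, hR₁⟩ := hQ
  have hu1 : Computable fun z : ℕ => (Nat.unpair z).1 := Computable.fst.comp Computable.unpair
  have hu2 : Computable fun z : ℕ => (Nat.unpair z).2 := Computable.snd.comp Computable.unpair
  have hpair : Computable₂ Nat.pair := Primrec₂.natPair.to_comp
  obtain ⟨i, hi⟩ := OracleCode.exists_of_computable
    (f := fun z => s (Nat.unpair z).1) (hs.comp hu1)
  obtain ⟨p, hp⟩ := OracleCode.exists_of_computable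
    (f := fun z => Nat.pair (h (Nat.unpair z).1) (Nat.unpair z).2)
    (hpair.comp (hh.comp hu1) hu2)
  obtain ⟨t, ht⟩ := OracleCode.exists_of_computable
    (f := fun z => Nat.casesOn (Nat.unpair z).1 (Nat.unpair (Nat.unpair z).2).1
      fun _ => (Nat.unpair (Nat.unpair z).2).2)
    (Computable.nat_casesOn (g := fun z => (Nat.unpair (Nat.unpair z).2).1)
      (h := fun z _ => (Nat.unpair (Nat.unpair z).2).2) hu1 (hu1.comp hu2) ((hu2.comp hu2).comp Computable.fst).to₂)
  refine ⟨fun f x y => if s x = 0 then R₀ f (h x) y else R₁ f (h x) y,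
    ⟨.comp t (.pair i (.pair (.comp e₀ p) (.comp e₁ p))), ?_⟩, ?_⟩
  · intro f x y
    obtain ⟨hd₀, hr₀⟩ := he₀ f (h x) y
    obtain ⟨hd₁, hr₁⟩ := he₁ f (h x) y
    obtain ⟨v₀, hv₀⟩ := Part.dom_iff_mem.1 hd₀
    obtain ⟨v₁, hv₁⟩ := Part.dom_iff_mem.1 hd₁
    have hv₀' := Part.eq_some_iff.2 hv₀
    have hv₁' := Part.eq_some_iff.2 hv₁
    rw [hv₀', Part.mem_some_iff] at hr₀
    rw [hv₁', Part.mem_some_iff] at hr₁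
    have key : OracleCode.eval (joinFun f)
        (.comp t (.pair i (.pair (.comp e₀ p) (.comp e₁ p)))) (Nat.pair x y)
          = Part.some (Nat.casesOn (s x) v₀ fun _ => v₁) := by
      have hc₀ := (OracleCode.eval_comp (c := e₀) (hp (joinFun f) (Nat.pair x y))).trans
        (by simpa using hv₀')
      have hc₁ := (OracleCode.eval_comp (c := e₁) (hp (joinFun f) (Nat.pair x y))).trans
        (by simpa using hv₁')
      rw [OracleCode.eval_comp (OracleCode.eval_pair (hi _ _) (OracleCode.eval_pair hc₀ hc₁)), ht]
      simp
    rw [key, Part.mem_some_iff]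
    refine ⟨trivial, ?_⟩
    cases hsx : s x with
    | zero => simpa [hsx] using hr₀
    | succ k => simpa [hsx] using hr₁
  · intro a
    by_cases hsa : s a = 0
    · simpa [hsa] using hR₀ (h a)
    · simpa [hsa] using hR₁ (h a)

theorem IsE1.numberingJoin {n : ℕ} {ν μ : ℕ → Set ℕ} (hν : IsE1 n (numberingGraph ν))
    (hμ : IsE1 n (numberingGraph μ)) : IsE1 n (numberingGraph (numberingJoin ν μ)) := by
  have hu1 : Computable fun z : ℕ => (Nat.unpair z).1 := Computable.fst.comp Computable.unpair
  have hu2 : Computable fun z : ℕ => (Nat.unpair z).2 := Computable.snd.comp Computable.unpair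
  have hs : Computable fun z : ℕ => (Nat.unpair z).1 % 2 :=
    Primrec.nat_mod.to_comp.comp hu1 (Computable.const 2)
  have hh : Computable fun z : ℕ => Nat.pair ((Nat.unpair z).1 / 2) (Nat.unpair z).2 :=
    Primrec₂.natPair.to_comp.comp (Primrec.nat_div.to_comp.comp hu1 (Computable.const 2)) hu2
  have hG : numberingGraph (_root_.numberingJoin ν μ) =
      {z | if (Nat.unpair z).1 % 2 = 0
        then Nat.pair ((Nat.unpair z).1 / 2) (Nat.unpair z).2 ∈ numberingGraph ν
        else Nat.pair ((Nat.unpair z).1 / 2) (Nat.unpair z).2 ∈ numberingGraph μ} := by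
    ext z
    by_cases hz : (Nat.unpair z).1 % 2 = 0 <;>
      simp [numberingGraph, _root_.numberingJoin, hz]
  rw [hG]
  rcases hν with ⟨hn, hν⟩ | ⟨hn, hν⟩ <;> rcases hμ with ⟨hn', hμ⟩ | ⟨hn', hμ⟩
  · exact Or.inl ⟨hn, HasAnalyticalForm.cases hν hμ hs hh⟩
  · exact absurd hn' (Nat.not_even_iff_odd.2 hn)
  · exact absurd hn (Nat.not_even_iff_odd.2 hn')
  · exact Or.inr ⟨hn, HasAnalyticalForm.cases hν hμ hs hh⟩

/-- `ν ⊕ μ` as an `E¹ₙ`-computable numbering of `S`. -/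
def E1Numbering.join {n : ℕ} {S : Set (Set ℕ)} (ν μ : E1Numbering n S) : E1Numbering n S :=
  ⟨numberingJoin ν.1 μ.1, by
    refine ⟨Set.Subset.antisymm ?_ ?_, ν.2.2.numberingJoin μ.2.2⟩
    · rintro _ ⟨k, rfl⟩
      unfold numberingJoin
      split_ifs
      · exact ν.2.1.le (Set.mem_range_self _)
      · exact μ.2.1.le (Set.mem_range_self _)
    · intro A hA
      rw [← ν.2.1] at hA
      obtain ⟨k, rfl⟩ := hA
      exact ⟨2 * k, by simp [numberingJoin]⟩⟩

theorem E1Numbering.le_join_left {n : ℕ} {S : Set (Set ℕ)} (ν μ : E1Numbering n S) :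
    ν ≤ ν.join μ :=
  ⟨fun k => 2 * k, Primrec.nat_mul.to_comp.comp (Computable.const 2) Computable.id,
    fun k => by simp [E1Numbering.join, numberingJoin]⟩

theorem E1Numbering.le_join_right {n : ℕ} {S : Set (Set ℕ)} (ν μ : E1Numbering n S) :
    μ ≤ ν.join μ :=
  ⟨fun k => 2 * k + 1, Computable.succ.comp
      (Primrec.nat_mul.to_comp.comp (Computable.const 2) Computable.id),
    fun k => by
      have h : (2 * k + 1) / 2 = k := by omega
      simp [E1Numbering.join, numberingJoin, h]⟩

theorem E1Numbering.join_le {n : ℕ} {S : Set (Set ℕ)} {ν μ ξ : E1Numbering n S}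
    (h₁ : ν ≤ ξ) (h₂ : μ ≤ ξ) : ν.join μ ≤ ξ := by
  obtain ⟨f, hf, hf'⟩ := h₁
  obtain ⟨g, hg, hg'⟩ := h₂
  have hd : Computable fun k : ℕ => k / 2 :=
    Primrec.nat_div.to_comp.comp Computable.id (Computable.const 2)
  have hm : Computable fun k : ℕ => k % 2 :=
    Primrec.nat_mod.to_comp.comp Computable.id (Computable.const 2)
  refine ⟨fun k => Nat.casesOn (k % 2) (f (k / 2)) fun _ => g (k / 2),
    Computable.nat_casesOn (g := fun k => f (k / 2)) (h := fun k _ => g (k / 2)) hm (hf.comp hd)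
      ((hg.comp hd).comp Computable.fst).to₂, fun k => ?_⟩
  change numberingJoin ν.1 μ.1 k = _
  unfold numberingJoin
  cases hk : k % 2 with
  | zero => simpa [hk] using hf' (k / 2)
  | succ j => simpa [hk] using hg' (k / 2)

/-- The Rogers semilattice `R¹ₙ(S)` as an upper semilattice, with join induced by `⊕`. -/
instance RogersE1.instSemilatticeSup (n : ℕ) (S : Set (Set ℕ)) :
    SemilatticeSup (RogersE1 n S) where
  sup := Quotient.map₂ E1Numbering.join fun _ _ ha _ _ hb =>
    ⟨E1Numbering.join_le (le_trans ha.1 (E1Numbering.le_join_left _ _))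
        (le_trans hb.1 (E1Numbering.le_join_right _ _)),
      E1Numbering.join_le (le_trans ha.2 (E1Numbering.le_join_left _ _))
        (le_trans hb.2 (E1Numbering.le_join_right _ _))⟩
  le_sup_left := by
    rintro ⟨a⟩ ⟨b⟩
    exact E1Numbering.le_join_left a b
  le_sup_right := by
    rintro ⟨a⟩ ⟨b⟩
    exact E1Numbering.le_join_right a b
  sup_le := by
    rintro ⟨a⟩ ⟨b⟩ ⟨c⟩ h₁ h₂
    exact E1Numbering.join_le h₁ h₂

/-! Fix distinct `A`, `B` in `S`. A finite family has a least numbering `κ`, for which membership of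
an index in the fibre over `A` is decidable (`exists_least_numbering`). To a predicate `D` attach `κ
⊕ ν_D`, where `ν_D` takes the value `A` on `D` and `B` elsewhere. Many-one reductions between
predicates give reductions between these numberings, and if `c ≤ κ ⊕ ν_D` with `D` nontrivial, then
the fibre of `c` over `A` many-one reduces to `D`.

The pair without a greatest lower bound comes from totality of programs and its negation. Suppose
`c` were a greatest lower bound and let `W` be its fibre over `A`. Then `W` reduces to both
predicates, and hence so does `CoDiagonal W`. The numbering attached to `CoDiagonal W` is therefore
a lower bound, so it lies below `c`, and `CoDiagonal W` reduces to `W`. This contradicts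
diagonalization (`not_coDiagonal_manyOneReducible`).

The definability input is `HasAnalyticalForm.switch`: in an `E¹ₙ` form the last function quantifier
is universal, so it can also range over witnesses that decide totality.

Infinitude follows, since a finite upper semilattice with a least element is a lattice. -/

/-! ### Substituting a program for the oracle -/

/-- Replace every call of the oracle in a program by the program `d`. -/
def OracleCode.subst (d : OracleCode) : OracleCode → OracleCode
  | .zero => .zero
  | .succ => .succ
  | .left => .left
  | .right => .right
  | .oracle => d
  | .pair a b => .pair (subst d a) (subst d b)
  | .comp a b => .comp (subst d a) (subst d b)
  | .prec a b => .prec (subst d a) (subst d b)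
  | .rfind a => .rfind (subst d a)

theorem OracleCode.eval_subst {g g' : ℕ → ℕ} {d : OracleCode}
    (hd : ∀ k, OracleCode.eval g d k = Part.some (g' k)) (e : OracleCode) :
    OracleCode.eval g (OracleCode.subst d e) = OracleCode.eval g' e := by
  induction e with
  | zero | succ | left | right => rfl
  | oracle => exact funext hd
  | pair a b ha hb | comp a b ha hb | prec a b ha hb =>
    simp only [OracleCode.subst, OracleCode.eval, ha, hb]
    rfl
  | rfind a ha =>
    simp only [OracleCode.subst, OracleCode.eval, ha]
    rfl

/-! ### Changing the matrix of an analytical normal form -/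

/-- The parity condition makes the innermost function quantifier universal, with an existential
number quantifier after it. Peeling off the outer quantifiers leaves that inner block to compare,
with the earlier functions fixed. -/
theorem alternatingPrefix_congr_last :
    ∀ (m : ℕ) (b : Bool) (_ : b = true ↔ Even m)
      (P Q : (Fin (m + 1) → ℕ → ℕ) → ℕ → Prop),
      (∀ fs : Fin m → ℕ → ℕ, (∀ F, ∃ y, P (Fin.snoc fs F) y) ↔ ∀ F, ∃ y, Q (Fin.snoc fs F) y) →
      (AlternatingPrefix b (m + 1) P ↔ AlternatingPrefix b (m + 1) Q)
  | 0, b, hb, P, Q, h => by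
    obtain rfl : b = true := hb.2 (by simp)
    have hs : ∀ F : ℕ → ℕ, (Fin.snoc (Fin.elim0 : Fin 0 → ℕ → ℕ) F : Fin 1 → ℕ → ℕ)
        = Fin.cons F (Fin.elim0 : Fin 0 → ℕ → ℕ) := fun F => by
      funext i
      obtain rfl : i = Fin.last 0 := Fin.ext (by omega)
      rfl
    have := h Fin.elim0
    simp only [hs] at this
    exact this
  | m + 1, b, hb, P, Q, h => by
    have ih : ∀ f : ℕ → ℕ, AlternatingPrefix (!b) (m + 1) (fun fs => P (Fin.cons f fs)) ↔
        AlternatingPrefix (!b) (m + 1) (fun fs => Q (Fin.cons f fs)) := fun f => by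
      refine alternatingPrefix_congr_last m (!b) ?_ _ _ fun fs => ?_
      · have := Nat.even_add_one (n := m)
        cases b <;> simp_all
      · simpa only [Fin.cons_snoc_eq_snoc_cons] using h (Fin.cons f fs)
    cases b with
    | true => exact forall_congr' ih
    | false => exact exists_congr ih

/-- Replace the last of the functions `f` by the first component of the pairs it codes. -/
def lastFst {m : ℕ} (f : Fin (m + 1) → ℕ → ℕ) : Fin (m + 1) → ℕ → ℕ :=
  Function.update f (Fin.last m) fun j => (Nat.unpair (f (Fin.last m) j)).1

/-- The second component of the pairs coded by the last of the functions `f`. -/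
def lastSnd {m : ℕ} (f : Fin (m + 1) → ℕ → ℕ) : ℕ → ℕ :=
  fun j => (Nat.unpair (f (Fin.last m) j)).2

theorem lastFst_snoc {m : ℕ} (fs : Fin m → ℕ → ℕ) (F : ℕ → ℕ) :
    lastFst (Fin.snoc fs F) = Fin.snoc fs fun j => (Nat.unpair (F j)).1 := by
  simp only [lastFst, Fin.snoc_last]
  exact Fin.update_snoc_last (α := fun _ => ℕ → ℕ) _ _ _

theorem joinFun_lastFst {m : ℕ} (f : Fin (m + 1) → ℕ → ℕ) (k : ℕ) :
    joinFun (lastFst f) k =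
      if (Nat.unpair k).1 = m then (Nat.unpair (joinFun f k)).1 else joinFun f k := by
  by_cases hk : (Nat.unpair k).1 = m
  · simp [joinFun, lastFst, hk, Fin.last]
  · by_cases hk2 : (Nat.unpair k).1 < m + 1
    · have hk' : (⟨(Nat.unpair k).1, hk2⟩ : Fin (m + 1)) ≠ Fin.last m := fun h =>
        hk (congrArg Fin.val h)
      simp [joinFun, lastFst, hk, hk2, Function.update_of_ne hk']
    · simp [joinFun, hk, hk2]

theorem OracleCode.exists_joinFun_lastFst (m : ℕ) : ∃ d : OracleCode,
    ∀ (f : Fin (m + 1) → ℕ → ℕ) (k : ℕ),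
      OracleCode.eval (joinFun f) d k = Part.some (joinFun (lastFst f) k) := by
  obtain ⟨ι, hι⟩ := OracleCode.exists_of_computable (f := fun z => z) Computable.id
  obtain ⟨d, hd⟩ := OracleCode.exists_of_computable
    (f := fun z => if (Nat.unpair (Nat.unpair z).1).1 = m then (Nat.unpair (Nat.unpair z).2).1
      else (Nat.unpair z).2)
    (by
      refine Primrec.to_comp (Primrec.ite (PrimrecRel.comp Primrec.eq ?_ (Primrec.const m)) ?_ ?_)
      · exact Primrec.fst.comp (Primrec.unpair.comp (Primrec.fst.comp Primrec.unpair))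
      · exact Primrec.fst.comp (Primrec.unpair.comp (Primrec.snd.comp Primrec.unpair))
      · exact Primrec.snd.comp Primrec.unpair)
  -- The post-processing program must see the query as well as the answer, because only answers
  -- belonging to the last function are projected.
  refine ⟨.comp d (.pair ι .oracle), fun f k => ?_⟩
  have ho : OracleCode.eval (joinFun f) .oracle k = Part.some (joinFun f k) := rfl
  rw [OracleCode.eval_comp (OracleCode.eval_pair (hι _ k) ho), hd, joinFun_lastFst]
  simp only [Nat.unpair_pair]

theorem OracleCode.exists_lastSnd (m : ℕ) {j : ℕ → ℕ} (hj : Computable j) : ∃ d : OracleCode,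
    ∀ (f : Fin (m + 1) → ℕ → ℕ) (z : ℕ),
      OracleCode.eval (joinFun f) d z = Part.some (lastSnd f (j z)) := by
  obtain ⟨q, hq⟩ := OracleCode.exists_of_computable (f := fun z => Nat.pair m (j z))
    (Primrec₂.natPair.to_comp.comp (Computable.const m) hj)
  refine ⟨.comp .right (.comp .oracle q), fun f z => ?_⟩
  have ho : OracleCode.eval (joinFun f) (.comp .oracle q) z
      = Part.some (joinFun f (Nat.pair m (j z))) := OracleCode.eval_comp (hq _ z)
  have hv : joinFun f (Nat.pair m (j z)) = f (Fin.last m) (j z) := by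
    simp [joinFun, Fin.last]
  rw [OracleCode.eval_comp ho, hv]
  rfl

/-- A set that is one of two sets with analytical normal forms, according to a predicate `D`
which can be read off every member of a nonempty `Π⁰₁` class, has an analytical normal form,
provided that its last function quantifier is universal. -/
theorem HasAnalyticalForm.switch {m : ℕ} {b : Bool} (hb : b = true ↔ Even m) {P Q : Set ℕ}
    (hP : HasAnalyticalForm b (m + 1) P) (hQ : HasAnalyticalForm b (m + 1) Q)
    {τ : ℕ → ℕ} (hτ : Computable τ) {D : ℕ → Prop}
    (hne : ∀ x, ∃ g : ℕ → ℕ, ∀ y,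
      τ (Nat.pair (Nat.pair x y) (Nat.pair (g 0) (g (y + 1)))) = 0)
    (hD : ∀ x, ∀ g : ℕ → ℕ,
      (∀ y, τ (Nat.pair (Nat.pair x y) (Nat.pair (g 0) (g (y + 1)))) = 0) → (g 0 = 0 ↔ D x)) :
    HasAnalyticalForm b (m + 1) {x | (D x ∧ x ∈ P) ∨ (¬ D x ∧ x ∈ Q)} := by
  obtain ⟨R₀, ⟨e₀, he₀⟩, hR₀⟩ := hP
  obtain ⟨R₁, ⟨e₁, he₁⟩, hR₁⟩ := hQ
  have hu1 : Computable fun z : ℕ => (Nat.unpair z).1 := Computable.fst.comp Computable.unpair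
  have hu2 : Computable fun z : ℕ => (Nat.unpair z).2 := Computable.snd.comp Computable.unpair
  -- Three verdicts: `0` and `1` choose the matrix of `P` or of `Q`, and `2` reports that the
  -- witness has left the class, in which case the new matrix accepts.
  let sel : ℕ → ℕ := fun z => Nat.casesOn (τ z)
    (Nat.casesOn (Nat.unpair (Nat.unpair z).2).1 0 fun _ => 1) fun _ => 2
  have hsel : Computable sel :=
    Computable.nat_casesOn (h := fun _ _ => 2) hτ
      (Computable.nat_casesOn (g := fun _ => 0) (h := fun _ _ => 1) (hu1.comp hu2)
        (Computable.const 0) (Computable.const 1).to₂) (Computable.const 2).to₂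
  obtain ⟨ι, hι⟩ := OracleCode.exists_of_computable (f := fun z => z) Computable.id
  obtain ⟨i, hi⟩ := OracleCode.exists_of_computable hsel
  obtain ⟨d, hd⟩ := OracleCode.exists_joinFun_lastFst m
  obtain ⟨q₀, hq₀⟩ := OracleCode.exists_lastSnd m (j := fun _ => 0) (Computable.const 0)
  obtain ⟨q₁, hq₁⟩ := OracleCode.exists_lastSnd m (j := fun z => (Nat.unpair z).2 + 1)
    (Computable.succ.comp hu2)
  obtain ⟨t, ht⟩ := OracleCode.exists_of_computable
    (f := fun z => Nat.casesOn (Nat.unpair z).1 (Nat.unpair (Nat.unpair z).2).1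
      fun k => Nat.casesOn k (Nat.unpair (Nat.unpair z).2).2 fun _ => 1)
    (Computable.nat_casesOn (g := fun z => (Nat.unpair (Nat.unpair z).2).1)
      (h := fun z k => Nat.casesOn k (Nat.unpair (Nat.unpair z).2).2 fun _ => 1)
      hu1 (hu1.comp hu2)
      (Computable.nat_casesOn (f := fun p : ℕ × ℕ => p.2)
        (g := fun p : ℕ × ℕ => (Nat.unpair (Nat.unpair p.1).2).2) (h := fun _ _ => 1)
        Computable.snd ((hu2.comp hu2).comp Computable.fst) (Computable.const 1).to₂).to₂)
  let cls : (Fin (m + 1) → ℕ → ℕ) → ℕ → ℕ → ℕ := fun f x y =>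
    τ (Nat.pair (Nat.pair x y) (Nat.pair (lastSnd f 0) (lastSnd f (y + 1))))
  refine ⟨fun f x y => cls f x y ≠ 0 ∨
      if lastSnd f 0 = 0 then R₀ (lastFst f) x y else R₁ (lastFst f) x y, ⟨.comp t (.pair
        (.comp i (.pair ι (.pair q₀
          q₁)))
        (.pair (OracleCode.subst d e₀)
          (OracleCode.subst d e₁))), ?_⟩, ?_⟩
  · intro f x y
    obtain ⟨hdom₀, hr₀⟩ := he₀ (lastFst f) x y
    obtain ⟨hdom₁, hr₁⟩ := he₁ (lastFst f) x y
    obtain ⟨v₀, hv₀⟩ := Part.dom_iff_mem.1 hdom₀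
    obtain ⟨v₁, hv₁⟩ := Part.dom_iff_mem.1 hdom₁
    have hv₀' := Part.eq_some_iff.2 hv₀
    have hv₁' := Part.eq_some_iff.2 hv₁
    rw [hv₀', Part.mem_some_iff] at hr₀
    rw [hv₁', Part.mem_some_iff] at hr₁
    rw [← OracleCode.eval_subst (hd f)] at hv₀' hv₁'
    have hq₁' := hq₁ f (Nat.pair x y)
    simp only [Nat.unpair_pair] at hq₁'
    rw [OracleCode.eval_comp (OracleCode.eval_pair
      ((OracleCode.eval_comp (OracleCode.eval_pair (hι _ _) (OracleCode.eval_pair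
        (hq₀ f _) hq₁'))).trans (hi _ _))
      (OracleCode.eval_pair hv₀' hv₁')), ht, Part.mem_some_iff]
    refine ⟨trivial, ?_⟩
    simp only [Nat.unpair_pair, sel]
    change cls f x y ≠ 0 ∨ _ ↔ 1 = Nat.rec _ _ (Nat.rec _ _ (cls f x y))
    cases cls f x y with
    | succ k => exact iff_of_true (Or.inl (Nat.succ_ne_zero k)) rfl
    | zero =>
      cases lastSnd f 0 with
      | zero => simpa using hr₀
      | succ k => simpa using hr₁
  · intro a
    -- Treats both values of `D a` at once, with `R` to be taken as `R₀` or `R₁`. A second component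
    -- outside the class satisfies the new matrix at some `y`; one inside the class selects `R`.
    -- Conversely, pairing `F` with a member of the class recovers `R` for `F`.
    have hpre : ∀ R : (Fin (m + 1) → ℕ → ℕ) → ℕ → ℕ → Prop,
        (∀ f y, (lastSnd f 0 = 0 ↔ D a) →
          ((if lastSnd f 0 = 0 then R₀ (lastFst f) a y else R₁ (lastFst f) a y) ↔
            R (lastFst f) a y)) →
        (AlternatingPrefix b (m + 1) (fun f y => R f a y) ↔
          AlternatingPrefix b (m + 1) (fun f y => cls f a y ≠ 0 ∨
            if lastSnd f 0 = 0 then R₀ (lastFst f) a y else R₁ (lastFst f) a y)) := by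
      intro R hR
      refine alternatingPrefix_congr_last m b hb _ _ fun fs => ⟨fun h F => ?_, fun h F => ?_⟩
      · by_cases hc : ∀ y, cls (Fin.snoc fs F) a y = 0
        · obtain ⟨y, hy⟩ := h fun j => (Nat.unpair (F j)).1
          refine ⟨y, Or.inr ((hR _ y (hD a _ hc)).2 ?_)⟩
          simpa only [lastFst_snoc] using hy
        · push Not at hc
          obtain ⟨y, hy⟩ := hc
          exact ⟨y, Or.inl hy⟩
      · obtain ⟨g, hg'⟩ := hne a
        obtain ⟨y, hy⟩ := h fun j => Nat.pair (F j) (g j)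
        have hgf : lastSnd (Fin.snoc fs fun j => Nat.pair (F j) (g j)) = g := by
          funext j
          simp [lastSnd]
        have hy' := hy.resolve_left fun h0 => h0 (by simpa only [cls, hgf] using hg' y)
        refine ⟨y, ?_⟩
        have := (hR _ y (by rw [hgf]; exact hD a g hg')).1 hy'
        simpa only [lastFst_snoc, Nat.unpair_pair] using this
    by_cases hDa : D a
    · simp only [Set.mem_ofPred_eq, hDa, true_and, not_true, false_and, or_false]
      exact (hR₀ a).trans (hpre R₀ fun f y hf => by rw [if_pos (hf.2 hDa)])
    · simp only [Set.mem_ofPred_eq, hDa, true_and, not_false_eq_true, false_and, false_or]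
      exact (hR₁ a).trans (hpre R₁ fun f y hf => by rw [if_neg fun h0 => hDa (hf.1 h0)])

/-! ### Programs that halt on every input -/

section TotalCodes

open Nat.Partrec

/-- The set of all programs that halt on every input. -/
def IsTotalCode (c : ℕ) : Prop := ∀ u, (Code.eval (Denumerable.ofNat Code c) u).Dom

theorem exists_isTotalCode : ∃ c, IsTotalCode c :=
  ⟨Encodable.encode Code.id, fun u => by simp [Code.eval_id]⟩

theorem exists_not_isTotalCode : ∃ c, ¬ IsTotalCode c := by
  obtain ⟨c, hc⟩ := Code.exists_code.1 Nat.Partrec.none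
  exact ⟨Encodable.encode c, fun h => by simpa [hc] using h 0⟩

/-- Totality of the members of a uniformly partial recursive family reduces to totality of
programs. -/
theorem exists_computable_isTotalCode_iff {F : ℕ → ℕ →. ℕ} (hF : Partrec₂ F) :
    ∃ r : ℕ → ℕ, Computable r ∧ ∀ e, IsTotalCode (r e) ↔ ∀ u, (F e u).Dom := by
  obtain ⟨c, hc⟩ := Code.exists_code.1 (Partrec.nat_iff.1
    (hF.comp (Computable.fst.comp Computable.unpair) (Computable.snd.comp Computable.unpair)))
  refine ⟨fun e => Encodable.encode (Code.curry c e), Computable.encode.comp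
    ((Code.primrec₂_curry.comp (Primrec.const c) Primrec.id).to_comp), fun e => ?_⟩
  simp [IsTotalCode, Code.eval_curry, hc]

/-- The complement of the diagonal `{e : φ_e(e)↓ ∈ W}`. -/
def CoDiagonal (W : ℕ → Prop) (e : ℕ) : Prop :=
  ¬ ∃ v ∈ Code.eval (Denumerable.ofNat Code e) e, W v

theorem not_coDiagonal_manyOneReducible (W : ℕ → Prop) : ¬ CoDiagonal W ≤₀ W := by
  rintro ⟨r, hr, h⟩
  obtain ⟨c, hc⟩ := Code.exists_code.1 (Partrec.nat_iff.1 hr.partrec)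
  -- At an index of the reduction `r` itself, the diagonal value is `r e`, so the reduction would
  -- make `W (r e)` equivalent to its negation.
  have := h (Encodable.encode c)
  simp [CoDiagonal, hc] at this

theorem partrec_diagonal : Partrec fun e : ℕ => Code.eval (Denumerable.ofNat Code e) e :=
  Code.eval_part.comp (Computable.ofNat Code) Computable.id

theorem partrec₂_eval_ofNat : Partrec₂ fun c u : ℕ => Code.eval (Denumerable.ofNat Code c) u :=
  Code.eval_part.comp ((Computable.ofNat Code).comp Computable.fst) Computable.snd

/-- With `p` reducing `W` to totality, the program that waits for `φ_e(e) = v` and then runs `φ_{p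
v}` is total exactly when `v` exists and lies in `W`. -/
theorem coDiagonal_manyOneReducible_not {W : ℕ → Prop} (h : W ≤₀ IsTotalCode) :
    CoDiagonal W ≤₀ fun c => ¬ IsTotalCode c := by
  obtain ⟨p, hp, hW⟩ := h
  obtain ⟨r, hr, hr'⟩ := exists_computable_isTotalCode_iff
    (F := fun e u => (Code.eval (Denumerable.ofNat Code e) e).bind fun v =>
      Code.eval (Denumerable.ofNat Code (p v)) u)
    (Partrec.bind (partrec_diagonal.comp Computable.fst)
      (partrec₂_eval_ofNat.comp (hp.comp Computable.snd)
        (Computable.snd.comp Computable.fst)).to₂)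
  refine ⟨r, hr, fun e => ?_⟩
  change _ ↔ ¬ IsTotalCode (r e)
  rw [hr', CoDiagonal, not_iff_not]
  constructor
  · rintro ⟨v, hv, hWv⟩ u
    rw [Part.eq_some_iff.2 hv, Part.bind_some]
    exact (hW v).1 hWv u
  · intro h
    obtain ⟨v, hv⟩ := Part.dom_iff_mem.1 (Part.Dom.of_bind (h 0))
    refine ⟨v, hv, (hW v).2 fun u => ?_⟩
    have := h u
    rwa [Part.eq_some_iff.2 hv, Part.bind_some] at this

/-- Here waiting must not cause divergence. On input `⟨k, w⟩` the diagonal computation is run with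
bound `k`: without a result the output is `0`, and a result `v` starts `φ_{q v}(w)`. This is total
unless `φ_e(e)` converges to a member of `W`. -/
theorem coDiagonal_manyOneReducible {W : ℕ → Prop} (h : W ≤₀ fun c => ¬ IsTotalCode c) :
    CoDiagonal W ≤₀ IsTotalCode := by
  obtain ⟨q, hq, hW⟩ := h
  let o : ℕ × ℕ → Option ℕ := fun a =>
    Code.evaln (Nat.unpair a.2).1 (Denumerable.ofNat Code a.1) a.1
  have ho : Computable o := Primrec.to_comp (Code.primrec_evaln.comp
    (Primrec.pair (Primrec.pair (Primrec.fst.comp (Primrec.unpair.comp Primrec.snd))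
      ((Primrec.ofNat Code).comp Primrec.fst)) Primrec.fst))
  obtain ⟨r, hr, hr'⟩ := exists_computable_isTotalCode_iff
    (F := fun e u => Option.casesOn (o (e, u)) (Part.some 0) fun v =>
      Code.eval (Denumerable.ofNat Code (q v)) (Nat.unpair u).2)
    (Partrec.to₂ <| Partrec.optionCasesOn_right (o := o) (f := fun _ => 0)
      (g := fun a v => Code.eval (Denumerable.ofNat Code (q v)) (Nat.unpair a.2).2)
      ho (Computable.const 0)
      (partrec₂_eval_ofNat.comp (hq.comp Computable.snd)
        (Computable.snd.comp (Computable.unpair.comp (Computable.snd.comp Computable.fst)))).to₂)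
  refine ⟨r, hr, fun e => ?_⟩
  rw [hr', CoDiagonal]
  constructor
  · intro h u
    cases hou : o (e, u) with
    | none => trivial
    | some v =>
      have hv : ¬ W v := fun hWv => h ⟨v, Code.evaln_sound hou, hWv⟩
      rw [hW, not_not] at hv
      exact hv _
  · rintro h ⟨v, hv, hWv⟩
    refine (hW v).1 hWv fun w => ?_
    obtain ⟨k, hk⟩ := Code.evaln_complete.1 hv
    have hu := h (Nat.pair k w)
    have hou : o (e, Nat.pair k w) = some v := by simpa [o] using hk
    simpa [hou] using hu

/-- A matrix defining a `Π⁰₁` class from which totality of a program can be read off. -/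
def totalityMatrix (z : ℕ) : ℕ :=
  Nat.casesOn (Nat.unpair (Nat.unpair z).2).1
    (Option.casesOn (Code.evaln (Nat.unpair (Nat.unpair z).2).2
      (Denumerable.ofNat Code (Nat.unpair (Nat.unpair z).1).1) (Nat.unpair (Nat.unpair z).1).2)
      1 fun _ => 0)
    fun u => Option.casesOn (Code.evaln (Nat.unpair (Nat.unpair z).1).2
      (Denumerable.ofNat Code (Nat.unpair (Nat.unpair z).1).1) u) 0 fun _ => 1

theorem computable_totalityMatrix : Computable totalityMatrix := by
  have h1 : Primrec fun z : ℕ => (Nat.unpair z).1 := Primrec.fst.comp Primrec.unpair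
  have h2 : Primrec fun z : ℕ => (Nat.unpair z).2 := Primrec.snd.comp Primrec.unpair
  refine Primrec.to_comp (Primrec.nat_casesOn (h1.comp h2) ?_ ?_)
  · exact Primrec.option_casesOn (g := fun _ _ => 0)
      (Code.primrec_evaln.comp (Primrec.pair (Primrec.pair (h2.comp h2)
        ((Primrec.ofNat Code).comp (h1.comp h1))) (h2.comp h1)))
      (Primrec.const 1) (Primrec.const 0).to₂
  · exact Primrec.to₂ <| Primrec.option_casesOn (g := fun _ _ => 1)
      (Code.primrec_evaln.comp (Primrec.pair (Primrec.pair (h2.comp (h1.comp Primrec.fst))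
        ((Primrec.ofNat Code).comp (h1.comp (h1.comp Primrec.fst)))) Primrec.snd))
      (Primrec.const 0) (Primrec.const 1).to₂

/-- A witness either has `g 0 = 0` and lists in `g (y + 1)` an evaluation bound sufficient for input
`y`, or has `g 0 = u + 1` and names an input `u` on which the program diverges. -/
theorem exists_totalityMatrix_eq_zero (x : ℕ) : ∃ g : ℕ → ℕ, ∀ y,
    totalityMatrix (Nat.pair (Nat.pair x y) (Nat.pair (g 0) (g (y + 1)))) = 0 := by
  by_cases hx : IsTotalCode x
  · choose v hv using fun u => Part.dom_iff_mem.1 (hx u)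
    choose k hk using fun u => Code.evaln_complete.1 (hv u)
    refine ⟨fun j => Nat.casesOn j 0 k, fun y => ?_⟩
    simp [totalityMatrix, Option.mem_def.1 (hk y)]
  · obtain ⟨u, hu⟩ := not_forall.1 hx
    refine ⟨fun _ => u + 1, fun y => ?_⟩
    have : Code.evaln y (Denumerable.ofNat Code x) u = Option.none := by
      cases h : Code.evaln y (Denumerable.ofNat Code x) u with
      | none => rfl
      | some v => exact absurd (Part.dom_iff_mem.2 ⟨v, Code.evaln_sound h⟩) hu
    simp [totalityMatrix, this]

theorem eq_zero_iff_isTotalCode {x : ℕ} {g : ℕ → ℕ} (hg : ∀ y,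
    totalityMatrix (Nat.pair (Nat.pair x y) (Nat.pair (g 0) (g (y + 1)))) = 0) :
    g 0 = 0 ↔ IsTotalCode x := by
  cases h0 : g 0 with
  | zero =>
    refine iff_of_true rfl fun u => ?_
    have := hg u
    cases h : Code.evaln (g (u + 1)) (Denumerable.ofNat Code x) u with
    | none => simp [totalityMatrix, h0, h] at this
    | some v => exact Part.dom_iff_mem.2 ⟨v, Code.evaln_sound h⟩
  | succ u =>
    refine iff_of_false (by simp) fun hx => ?_
    obtain ⟨v, hv⟩ := Part.dom_iff_mem.1 (hx u)
    obtain ⟨k, hk⟩ := Code.evaln_complete.1 hv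
    have := hg k
    simp [totalityMatrix, h0, Option.mem_def.1 hk] at this

end TotalCodes

/-! ### Numberings of finite families -/

/-- For either parity of `n` the last function quantifier is universal, which is the shape
`HasAnalyticalForm.switch` requires. -/
theorem IsE1.exists_form {n : ℕ} (hn : 1 ≤ n) : ∃ (m : ℕ) (b : Bool), n = m + 1 ∧
    (b = true ↔ Even m) ∧ ∀ X, IsE1 n X ↔ HasAnalyticalForm b (m + 1) X := by
  obtain ⟨m, rfl⟩ : ∃ m, n = m + 1 := ⟨n - 1, by omega⟩
  by_cases h : Even m
  · exact ⟨m, true, rfl, by simp [h],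
      fun X => by simp [IsE1, IsPi1, Nat.even_add_one, h, h.add_one]⟩
  · refine ⟨m, false, rfl, by simp [h], fun X => ?_⟩
    have : ¬ Odd (m + 1) := by simpa [Nat.even_add_one] using h
    simp [IsE1, IsSigma1, Nat.even_add_one, h, this]

theorem IsE1.preimage {n : ℕ} {X : Set ℕ} (hX : IsE1 n X) {h : ℕ → ℕ} (hh : Computable h) :
    IsE1 n {x | h x ∈ X} := by
  have key : ∀ b, HasAnalyticalForm b n X → HasAnalyticalForm b n {x | h x ∈ X} := fun b H => by
    simpa using HasAnalyticalForm.cases H H (Computable.const 0) hh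
  exact hX.imp (And.imp_right (key true)) (And.imp_right (key false))

theorem IsE1.numberingGraph_comp {n : ℕ} {ν : ℕ → Set ℕ} (hν : IsE1 n (numberingGraph ν))
    {r : ℕ → ℕ} (hr : Computable r) : IsE1 n (numberingGraph (ν ∘ r)) := by
  have := hν.preimage (h := fun z => Nat.pair (r (Nat.unpair z).1) (Nat.unpair z).2)
    (Primrec₂.natPair.to_comp.comp (hr.comp (Computable.fst.comp Computable.unpair))
      (Computable.snd.comp Computable.unpair))
  simpa [numberingGraph] using this

theorem IsE1.numberingGraph_const {n : ℕ} {A : Set ℕ} (hA : IsE1 n A) :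
    IsE1 n (numberingGraph fun _ => A) :=
  hA.preimage (Computable.snd.comp Computable.unpair)

open Classical in
/-- The numbering sending `k` to `A` if `D k` and to `B` otherwise. -/
noncomputable def switchNumbering (D : ℕ → Prop) (A B : Set ℕ) : ℕ → Set ℕ :=
  fun k => if D k then A else B

theorem switchNumbering_congr {D D' : ℕ → Prop} {A B : Set ℕ} {k l : ℕ} (h : D k ↔ D' l) :
    switchNumbering D A B k = switchNumbering D' A B l := by
  by_cases hk : D k
  · simp [switchNumbering, hk, h.1 hk]
  · simp [switchNumbering, hk, mt h.2 hk]

theorem switchNumbering_not (D : ℕ → Prop) (A B : Set ℕ) :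
    switchNumbering (fun k => ¬ D k) A B = switchNumbering D B A := by
  funext k
  by_cases h : D k <;> simp [switchNumbering, h]

theorem switchNumbering_eq_left_iff {D : ℕ → Prop} {A B : Set ℕ} (hAB : A ≠ B) (k : ℕ) :
    switchNumbering D A B k = A ↔ D k := by
  by_cases h : D k <;> simp [switchNumbering, h, hAB.symm]

theorem IsE1.numberingGraph_isTotalCode {n : ℕ} (hn : 1 ≤ n) {A B : Set ℕ} (hA : IsE1 n A)
    (hB : IsE1 n B) : IsE1 n (numberingGraph (switchNumbering IsTotalCode A B)) := by
  obtain ⟨m, b, rfl, hb, hE⟩ := IsE1.exists_form hn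
  have hu1 : Computable fun z : ℕ => (Nat.unpair z).1 := Computable.fst.comp Computable.unpair
  have hu2 : Computable fun z : ℕ => (Nat.unpair z).2 := Computable.snd.comp Computable.unpair
  have hpair : Computable₂ Nat.pair := Primrec₂.natPair.to_comp
  have hA' := (hE _).1 (hA.preimage hu2)
  have hB' := (hE _).1 (hB.preimage hu2)
  have := HasAnalyticalForm.switch hb hA' hB' (D := fun x => IsTotalCode (Nat.unpair x).1)
    (τ := fun z => totalityMatrix (Nat.pair
      (Nat.pair (Nat.unpair (Nat.unpair (Nat.unpair z).1).1).1
        (Nat.unpair (Nat.unpair z).1).2) (Nat.unpair z).2))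
    (computable_totalityMatrix.comp (hpair.comp (hpair.comp
      (hu1.comp (hu1.comp hu1)) (hu2.comp hu1)) hu2))
    (fun x => by simpa using exists_totalityMatrix_eq_zero _)
    (fun x g hg => by
      simp only [Nat.unpair_pair] at hg
      exact eq_zero_iff_isTotalCode hg)
  rw [hE]
  convert this using 1
  ext z
  by_cases h : IsTotalCode (Nat.unpair z).1 <;> simp [numberingGraph, switchNumbering, h]

theorem numberingJoin_even (ν μ : ℕ → Set ℕ) (k : ℕ) : numberingJoin ν μ (2 * k) = ν k := by
  simp [numberingJoin]

theorem numberingJoin_odd (ν μ : ℕ → Set ℕ) (k : ℕ) : numberingJoin ν μ (2 * k + 1) = μ k := by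
  have h : (2 * k + 1) / 2 = k := by omega
  simp [numberingJoin, h]

theorem range_numberingJoin (ν μ : ℕ → Set ℕ) :
    Set.range (numberingJoin ν μ) = Set.range ν ∪ Set.range μ := by
  ext A
  constructor
  · rintro ⟨k, rfl⟩
    unfold numberingJoin
    split_ifs
    · exact Or.inl ⟨_, rfl⟩
    · exact Or.inr ⟨_, rfl⟩
  · rintro (⟨k, rfl⟩ | ⟨k, rfl⟩)
    · exact ⟨2 * k, numberingJoin_even ν μ k⟩
    · exact ⟨2 * k + 1, numberingJoin_odd ν μ k⟩

theorem computable_parity_cases {f g : ℕ → ℕ} (hf : Computable f) (hg : Computable g) :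
    Computable fun k => if k % 2 = 0 then f (k / 2) else g (k / 2) := by
  have hd : Computable fun k : ℕ => k / 2 :=
    Primrec.nat_div.to_comp.comp Computable.id (Computable.const 2)
  have hm : Computable fun k : ℕ => k % 2 :=
    Primrec.nat_mod.to_comp.comp Computable.id (Computable.const 2)
  refine (Computable.nat_casesOn (g := fun k => f (k / 2)) (h := fun k _ => g (k / 2)) hm
    (hf.comp hd) ((hg.comp hd).comp Computable.fst).to₂).of_eq fun k => ?_
  cases hk : k % 2 <;> simp

theorem NumberingReducible.join_le {ν μ ξ : ℕ → Set ℕ} (h₁ : NumberingReducible ν ξ)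
    (h₂ : NumberingReducible μ ξ) : NumberingReducible (numberingJoin ν μ) ξ := by
  obtain ⟨f, hf, hf'⟩ := h₁
  obtain ⟨g, hg, hg'⟩ := h₂
  refine ⟨_, computable_parity_cases hf hg, fun k => ?_⟩
  unfold numberingJoin
  split_ifs
  · exact hf' _
  · exact hg' _

theorem manyOneReducible_numberingJoin {ν μ : ℕ → Set ℕ} {A : Set ℕ} {X : ℕ → Prop}
    (h₁ : (fun k => ν k = A) ≤₀ X) (h₂ : (fun k => μ k = A) ≤₀ X) :
    (fun k => numberingJoin ν μ k = A) ≤₀ X := by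
  obtain ⟨f, hf, hf'⟩ := h₁
  obtain ⟨g, hg, hg'⟩ := h₂
  refine ⟨_, computable_parity_cases hf hg, fun k => ?_⟩
  change numberingJoin ν μ k = A ↔ _
  unfold numberingJoin
  split_ifs
  · exact hf' _
  · exact hg' _

/-- A finite family of `E¹ₙ` sets has a computable numbering which is least among all numberings
of larger families and decides each of the sets. -/
theorem exists_least_numbering {n : ℕ} {S : Set (Set ℕ)} (hfin : S.Finite) (hS : S.Nonempty)
    (hE : ∀ A ∈ S, IsE1 n A) : ∃ κ : ℕ → Set ℕ, Set.range κ = S ∧ IsE1 n (numberingGraph κ) ∧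
      (∀ ν : ℕ → Set ℕ, S ⊆ Set.range ν → NumberingReducible κ ν) ∧
      ∀ (A : Set ℕ) (X : ℕ → Prop), (∃ k, X k) → (∃ k, ¬ X k) → (fun k => κ k = A) ≤₀ X := by
  -- One-element families have constant numberings with all the properties; joins then add one set
  -- at a time.
  have hconst : ∀ B, IsE1 n B → IsE1 n (numberingGraph fun _ => B) ∧
      (∀ ν : ℕ → Set ℕ, B ∈ Set.range ν → NumberingReducible (fun _ => B) ν) ∧
      ∀ (A : Set ℕ) (X : ℕ → Prop), (∃ k, X k) → (∃ k, ¬ X k) →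
        (fun _ : ℕ => B = A) ≤₀ X := by
    refine fun B hB => ⟨hB.numberingGraph_const, ?_, ?_⟩
    · rintro ν ⟨k, hk⟩
      exact ⟨fun _ => k, Computable.const k, fun _ => hk.symm⟩
    · rintro A X ⟨k, hk⟩ ⟨l, hl⟩
      by_cases h : B = A
      · exact ⟨fun _ => k, Computable.const k, fun _ => by simp [h, hk]⟩
      · exact ⟨fun _ => l, Computable.const l, fun _ => by simp [h, hl]⟩
  induction S, hfin using Set.Finite.induction_on with
  | empty => exact absurd hS Set.not_nonempty_empty
  | @insert B S hBS hfin ih =>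
    obtain ⟨h1, h2, h3⟩ := hconst B (hE B (Set.mem_insert _ _))
    rcases S.eq_empty_or_nonempty with rfl | hS
    · exact ⟨fun _ => B, by simp, h1, fun ν hν => h2 ν (hν (Set.mem_insert _ _)), h3⟩
    obtain ⟨κ, hκ, hκE, hκl, hκA⟩ := ih hS fun A hA => hE A (Set.mem_insert_of_mem _ hA)
    refine ⟨numberingJoin (fun _ => B) κ, ?_, h1.numberingJoin hκE, fun ν hν =>
      (h2 ν (hν (Set.mem_insert _ _))).join_le (hκl ν ((Set.subset_insert _ _).trans hν)),
      fun A X hX hX' => manyOneReducible_numberingJoin (h3 A X hX hX') (hκA A X hX hX')⟩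
    rw [range_numberingJoin, hκ, Set.range_const, Set.singleton_union]

/-- A finite upper semilattice with a least element has all binary greatest lower bounds. -/
theorem exists_isGLB_pair_of_finite {α : Type*} [SemilatticeSup α] [Finite α] {o : α}
    (ho : ∀ a, o ≤ a) (a b : α) : ∃ c, IsGLB {a, b} c := by
  classical
  cases nonempty_fintype α
  -- The greatest lower bound is the join of all lower bounds; `o` is one of them.
  let s : Finset α := Finset.univ.filter fun c => c ≤ a ∧ c ≤ b
  have hs : s.Nonempty := ⟨o, by simp [s, ho]⟩
  refine ⟨s.sup' hs id, ?_, fun c hc => ?_⟩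
  · rintro x (rfl | rfl)
    · exact Finset.sup'_le _ _ fun c hc => (Finset.mem_filter.1 hc).2.1
    · exact Finset.sup'_le _ _ fun c hc => (Finset.mem_filter.1 hc).2.2
  · exact Finset.le_sup' id (Finset.mem_filter.2 ⟨Finset.mem_univ _, hc (by simp), hc (by simp)⟩)

/-! ### A pair without a greatest lower bound. -/

theorem exists_pair_not_isGLB (n : ℕ) (hn : 1 ≤ n) (S : Set (Set ℕ)) (hfin : S.Finite)
    (hE : ∀ A ∈ S, IsE1 n A) (htwo : S.Nontrivial) :
    ∃ a b : RogersE1 n S, ∀ c : RogersE1 n S, ¬ IsGLB {a, b} c := by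
  obtain ⟨A, hA, B, hB, hAB⟩ := htwo
  obtain ⟨κ, hκ, hκE, hκl, hκA⟩ := exists_least_numbering hfin ⟨A, hA⟩ hE
  have hrange : ∀ D : ℕ → Prop, Set.range (numberingJoin κ (switchNumbering D A B)) = S := by
    intro D
    rw [range_numberingJoin, hκ, Set.union_eq_left]
    rintro _ ⟨k, rfl⟩
    by_cases h : D k <;> simpa [switchNumbering, h]
  -- Joining with `κ` makes the numbering onto `S` without affecting comparisons, as `κ` lies below
  -- every numbering of `S`.
  let num : ∀ D : ℕ → Prop, IsE1 n (numberingGraph (switchNumbering D A B)) → E1Numbering n S :=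
    fun D h => ⟨numberingJoin κ (switchNumbering D A B), hrange D, hκE.numberingJoin h⟩
  have hle : ∀ {D D' : ℕ → Prop} (h : IsE1 n (numberingGraph (switchNumbering D A B)))
      (h' : IsE1 n (numberingGraph (switchNumbering D' A B))), D ≤₀ D' → num D h ≤ num D' h' := by
    rintro D D' h h' ⟨r, hr, hrD⟩
    refine NumberingReducible.join_le (hκl _ (hrange D').ge) ⟨fun k => 2 * r k + 1,
      Computable.succ.comp (Primrec.nat_mul.to_comp.comp (Computable.const 2) hr), fun k => ?_⟩
    change _ = numberingJoin κ (switchNumbering D' A B) (2 * r k + 1)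
    rw [numberingJoin_odd]
    exact switchNumbering_congr (hrD k)
  have hred : ∀ {D : ℕ → Prop} (h : IsE1 n (numberingGraph (switchNumbering D A B)))
      (c : E1Numbering n S), (∃ k, D k) → (∃ k, ¬ D k) → c ≤ num D h →
      (fun k => c.1 k = A) ≤₀ D := by
    rintro D h c hD hD' ⟨f, hf, hf'⟩
    have h1 : (fun k => (num D h).1 k = A) ≤₀ D :=
      manyOneReducible_numberingJoin (hκA A D hD hD')
        ⟨id, Computable.id, switchNumbering_eq_left_iff hAB⟩
    exact ManyOneReducible.trans ⟨f, hf, fun k => Eq.congr_left (hf' k)⟩ h1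
  have hT := IsE1.numberingGraph_isTotalCode hn (hE A hA) (hE B hB)
  have hN : IsE1 n (numberingGraph (switchNumbering (fun c => ¬ IsTotalCode c) A B)) := by
    -- Negating the predicate amounts to exchanging `A` and `B`, so no separate definability
    -- argument is needed.
    rw [switchNumbering_not]
    exact IsE1.numberingGraph_isTotalCode hn (hE B hB) (hE A hA)
  refine ⟨toAntisymmetrization _ (num _ hT), toAntisymmetrization _ (num _ hN), fun c => ?_⟩
  induction c using Quotient.inductionOn with
  | h c =>
  intro hc
  have hcT : (fun k => c.1 k = A) ≤₀ IsTotalCode :=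
    hred hT c exists_isTotalCode exists_not_isTotalCode (hc.1 (Set.mem_insert _ _))
  have hcN : (fun k => c.1 k = A) ≤₀ fun k => ¬ IsTotalCode k :=
    hred hN c exists_not_isTotalCode (by simpa using exists_isTotalCode)
      (hc.1 (Set.mem_insert_of_mem _ rfl))
  have hZT := coDiagonal_manyOneReducible hcN
  have hZN := coDiagonal_manyOneReducible_not hcT
  -- The reduction to totality also gives definability, by composing an `E¹ₙ`-computable numbering
  -- with a computable function.
  have hZ : IsE1 n (numberingGraph (switchNumbering (CoDiagonal fun k => c.1 k = A) A B)) := by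
    obtain ⟨r, hr, hrZ⟩ := hZT
    have heq : switchNumbering (CoDiagonal fun k => c.1 k = A) A B
        = switchNumbering IsTotalCode A B ∘ r := funext fun k => switchNumbering_congr (hrZ k)
    rw [heq]
    exact hT.numberingGraph_comp hr
  have hlower : toAntisymmetrization (· ≤ ·) (num _ hZ) ∈ lowerBounds
      {toAntisymmetrization (· ≤ ·) (num _ hT), toAntisymmetrization (· ≤ ·) (num _ hN)} := by
    rintro x (rfl | rfl)
    · exact hle hZ hT hZT
    · exact hle hZ hN hZN
  obtain ⟨f, hf, hf'⟩ : num _ hZ ≤ c := hc.2 hlower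
  refine not_coDiagonal_manyOneReducible (fun k => c.1 k = A) ⟨fun k => f (2 * k + 1),
    hf.comp (Computable.succ.comp
      (Primrec.nat_mul.to_comp.comp (Computable.const 2) Computable.id)), fun k => ?_⟩
  have hk : numberingJoin κ (switchNumbering _ A B) (2 * k + 1) = c.1 (f (2 * k + 1)) :=
    hf' (2 * k + 1)
  rw [numberingJoin_odd] at hk
  exact (switchNumbering_eq_left_iff hAB k).symm.trans (Eq.congr_left hk)

theorem mainTheorem6 (n : ℕ) (hn : 1 ≤ n) (S : Set (Set ℕ)) (hfin : S.Finite)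
    (hE : ∀ A ∈ S, IsE1 n A) (htwo : S.Nontrivial) :
    Infinite (RogersE1 n S) ∧
      ¬ ∀ a b : RogersE1 n S, ∃ c : RogersE1 n S, IsGLB {a, b} c := by
  obtain ⟨a, b, hab⟩ := exists_pair_not_isGLB n hn S hfin hE htwo
  have hnot : ¬ ∀ a b : RogersE1 n S, ∃ c : RogersE1 n S, IsGLB {a, b} c := fun h =>
    (h a b).elim hab
  refine ⟨not_finite_iff_infinite.1 fun _ => hnot ?_, hnot⟩
  obtain ⟨κ, hκ, hκE, hκl, -⟩ := exists_least_numbering hfin htwo.nonempty hE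
  refine exists_isGLB_pair_of_finite
    (o := toAntisymmetrization (· ≤ ·) (⟨κ, hκ, hκE⟩ : E1Numbering n S)) fun x => ?_
  induction x using Quotient.inductionOn with
  | h x => exact hκl x.1 x.2.1.ge
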